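/- Consider a single orchestrator-client link in direct multipartite entanglement distribution. Let $\eta_{\uparrow},\eta_{\downarrow}\in[0,1]$ be the efficiencies of the up-conversion at the orchestrator and of the down-conversion at the client, let $l\ge 0$ be the length and $L>0$ the attenuation length of the fiber, and let $$p=\eta_{\uparrow}\,\eta_{\downarrow}\,e^{-l/L}$$ be the probability of successfully distributing an ebit over the link. The link is modelled as the quantum erasure channel on one qubit with erasure probability $1-p$, i.e. the channel $$\rho\;\mapsto\; p\,\rho+(1-p)\,|\varepsilon\rangle\langle\varepsilon|$$ on density matrices $\rho$, where the erasure state $|\varepsilon\rangle$ is orthogonal to the qubit space. The one-way quantum capacity of a channel is the supremum of the rates $R\ge 0$ such that for every $\delta>0$ there are, for arbitrarily large $n$, codes that send at least $Rn$ qubits through $n$ independent uses of the channel with fidelity at least $1-\delta$ for every pure input state, where the sender may in addition send classical messages to the receiver for free (but not conversely); the unassisted quantum capacity is defined in the same way without classical messages. If the one-way quantum capacity of the link is non-zero, then $p>\tfrac12$. Likewise, if the unassisted quantum capacity of the link is non-zero, then $p>\tfrac12$. -/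

import Mathlib

open scoped ENNReal NNReal ComplexOrder

noncomputable section

namespace DMD

/-! ### Quantum channels in finite dimension

Operators on the Hilbert space with orthonormal basis indexed by `a` are matrices
`Matrix a a ℂ`. -/

/-- The map `id_k ⊗ Φ` on operators of `ℂ^k ⊗ ℂ^a`: apply `Φ` to each of the `k × k` blocks. -/
def ampliation {a b : Type*} (k : ℕ) (Φ : Matrix a a ℂ →ₗ[ℂ] Matrix b b ℂ)
    (M : Matrix (Fin k × a) (Fin k × a) ℂ) : Matrix (Fin k × b) (Fin k × b) ℂ :=
  Matrix.of fun q r => Φ (Matrix.of fun x y => M (q.1, x) (r.1, y)) q.2 r.2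

/-- Complete positivity: every `id_k ⊗ Φ` preserves positive semidefiniteness. -/
def IsCompletelyPositive {a b : Type*} (Φ : Matrix a a ℂ →ₗ[ℂ] Matrix b b ℂ) : Prop :=
  ∀ (k : ℕ) (M : Matrix (Fin k × a) (Fin k × a) ℂ),
    M.PosSemidef → (ampliation k Φ M).PosSemidef

/-- A quantum channel: a completely positive, trace-preserving linear map. -/
structure IsChannel {a b : Type*} [Fintype a] [Fintype b]
    (Φ : Matrix a a ℂ →ₗ[ℂ] Matrix b b ℂ) : Prop where
  completelyPositive : IsCompletelyPositive Φ
  tracePreserving : ∀ ρ, (Φ ρ).trace = ρ.trace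

/-- `n` parallel independent uses `Φ^{⊗n}` of `Φ`: the linear map sending the matrix unit
`|x⟩⟨x'| = ⨂ᵢ |xᵢ⟩⟨x'ᵢ|` to `⨂ᵢ Φ(|xᵢ⟩⟨x'ᵢ|)`. -/
def tensorPower {a b : Type*} [Fintype a] [DecidableEq a]
    (Φ : Matrix a a ℂ →ₗ[ℂ] Matrix b b ℂ) (n : ℕ) :
    Matrix (Fin n → a) (Fin n → a) ℂ →ₗ[ℂ] Matrix (Fin n → b) (Fin n → b) ℂ where
  toFun M := Matrix.of fun y y' =>
    ∑ x, ∑ x', M x x' * ∏ i, Φ (Matrix.single (x i) (x' i) 1) (y i) (y' i)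
  map_add' M M' := by
    ext y y'
    simp [add_mul, Finset.sum_add_distrib]
  map_smul' c M := by
    ext y y'
    simp [Finset.mul_sum, mul_assoc]

/-- The quantum erasure channel with survival probability `p` (erasure probability `1 - p`):
`ρ ↦ p ρ + (1 - p) (tr ρ) |ε⟩⟨ε|`, where the erasure state `|ε⟩` (the `Unit` summand) is
orthogonal to the input space. -/
def erasureChannel (a : Type*) [Fintype a] (p : ℝ) :
    Matrix a a ℂ →ₗ[ℂ] Matrix (a ⊕ Unit) (a ⊕ Unit) ℂ where
  toFun ρ := Matrix.fromBlocks ((p : ℂ) • ρ) 0 0 (Matrix.of fun _ _ => ((1 - p : ℝ) : ℂ) * ρ.trace)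
  map_add' ρ σ := by
    ext (i | i) (j | j) <;> simp [mul_add]
  map_smul' c ρ := by
    ext (i | i) (j | j) <;> simp [mul_left_comm]

/-! ### One-way quantum capacity -/

/-- A code sending `m` qubits through `n` uses of the channel `N`, with free forward (sender to
receiver) classical communication. The sender applies a quantum instrument `encode`, feeds the
quantum output into the `n` channel uses and sends the classical outcome `x` to the receiver, who
applies the channel `decode x`. A code without classical communication is one with a single
message. -/
structure OneWayCode (a b : Type*) [Fintype a] [Fintype b] (n m : ℕ) where
  /-- the number of classical messages -/
  messages : ℕ
  encode : Fin messages →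
    (Matrix (Fin m → Fin 2) (Fin m → Fin 2) ℂ →ₗ[ℂ] Matrix (Fin n → a) (Fin n → a) ℂ)
  decode : Fin messages →
    (Matrix (Fin n → b) (Fin n → b) ℂ →ₗ[ℂ] Matrix (Fin m → Fin 2) (Fin m → Fin 2) ℂ)
  encode_completelyPositive : ∀ x, IsCompletelyPositive (encode x)
  encode_tracePreserving : ∀ ρ, ∑ x, (encode x ρ).trace = ρ.trace
  decode_isChannel : ∀ x, IsChannel (decode x)

/-- The overall map on `m` qubits, `∑ₓ decodeₓ ∘ N^{⊗n} ∘ encodeₓ`. -/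
def OneWayCode.transmit {a b : Type*} [Fintype a] [DecidableEq a] [Fintype b] {n m : ℕ}
    (C : OneWayCode a b n m) (N : Matrix a a ℂ →ₗ[ℂ] Matrix b b ℂ) :
    Matrix (Fin m → Fin 2) (Fin m → Fin 2) ℂ →ₗ[ℂ]
      Matrix (Fin m → Fin 2) (Fin m → Fin 2) ℂ :=
  ∑ x, C.decode x ∘ₗ tensorPower N n ∘ₗ C.encode x

/-- Every pure `m`-qubit state `|ψ⟩` is transmitted with fidelity at least `1 - ε`:
`⟨ψ| T(|ψ⟩⟨ψ|) |ψ⟩ ≥ 1 - ε`, with `T` the overall map. -/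
def OneWayCode.HasFidelity {a b : Type*} [Fintype a] [DecidableEq a] [Fintype b] {n m : ℕ}
    (C : OneWayCode a b n m) (N : Matrix a a ℂ →ₗ[ℂ] Matrix b b ℂ) (ε : ℝ) : Prop :=
  ∀ ψ : (Fin m → Fin 2) → ℂ, star ψ ⬝ᵥ ψ = 1 →
    1 - ε ≤ (star ψ ⬝ᵥ (C.transmit N (Matrix.vecMulVec ψ (star ψ))).mulVec ψ).re

/-- The rate `R` (qubits per channel use) is achievable with forward classical communication: for
every `ε > 0` there are arbitrarily large block lengths `n` and codes sending at least `R n` qubits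
through `n` channel uses with fidelity at least `1 - ε`. -/
def IsOneWayAchievable {a b : Type*} [Fintype a] [DecidableEq a] [Fintype b]
    (N : Matrix a a ℂ →ₗ[ℂ] Matrix b b ℂ) (R : ℝ≥0) : Prop :=
  ∀ ε : ℝ, 0 < ε → ∃ᶠ n : ℕ in Filter.atTop, ∃ m : ℕ, (R : ℝ) * n ≤ m ∧
    ∃ C : OneWayCode a b n m, C.HasFidelity N ε

/-- The rate `R` is achievable without any classical communication. -/
def IsUnassistedAchievable {a b : Type*} [Fintype a] [DecidableEq a] [Fintype b]
    (N : Matrix a a ℂ →ₗ[ℂ] Matrix b b ℂ) (R : ℝ≥0) : Prop :=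
  ∀ ε : ℝ, 0 < ε → ∃ᶠ n : ℕ in Filter.atTop, ∃ m : ℕ, (R : ℝ) * n ≤ m ∧
    ∃ C : OneWayCode a b n m, C.messages = 1 ∧ C.HasFidelity N ε

/-- The one-way quantum capacity: the supremum of the rates achievable with free forward classical
communication. -/
def oneWayQuantumCapacity {a b : Type*} [Fintype a] [DecidableEq a] [Fintype b]
    (N : Matrix a a ℂ →ₗ[ℂ] Matrix b b ℂ) : ℝ≥0∞ :=
  ⨆ (R : ℝ≥0) (_ : IsOneWayAchievable N R), (R : ℝ≥0∞)

/-- The unassisted quantum capacity. -/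
def unassistedQuantumCapacity {a b : Type*} [Fintype a] [DecidableEq a] [Fintype b]
    (N : Matrix a a ℂ →ₗ[ℂ] Matrix b b ℂ) : ℝ≥0∞ :=
  ⨆ (R : ℝ≥0) (_ : IsUnassistedAchievable N R), (R : ℝ≥0∞)

/-! ### The orchestrator-client link -/

/-- The parameters of an orchestrator-client link in direct multipartite distribution: the
efficiencies (conversion probabilities) of the up-conversion at the orchestrator and of the
down-conversion at the client, and the length and the attenuation length of the fiber. -/
structure Link where
  upEfficiency : ℝ
  upEfficiency_mem : upEfficiency ∈ Set.Icc (0 : ℝ) 1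
  downEfficiency : ℝ
  downEfficiency_mem : downEfficiency ∈ Set.Icc (0 : ℝ) 1
  fiberLength : ℝ
  fiberLength_nonneg : 0 ≤ fiberLength
  attenuationLength : ℝ
  attenuationLength_pos : 0 < attenuationLength

/-- The probability `η↑ η↓ e^{-l/L}` of successfully distributing an ebit over the link. -/
def Link.ebitProbability (ℓ : Link) : ℝ :=
  ℓ.upEfficiency * ℓ.downEfficiency * Real.exp (-(ℓ.fiberLength / ℓ.attenuationLength))

/-- The cascade of up-conversion, fiber and down-conversion acting on one ebit (a qubit): the
quantum erasure channel whose erasure probability is one minus the ebit distribution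
probability. -/
def Link.channel (ℓ : Link) :
    Matrix (Fin 2) (Fin 2) ℂ →ₗ[ℂ] Matrix (Fin 2 ⊕ Unit) (Fin 2 ⊕ Unit) ℂ :=
  erasureChannel (Fin 2) ℓ.ebitProbability

end DMD

end

namespace DMD

open Matrix Kronecker

/-! ### Positivity of matrices -/

/-! For `p ≤ 1/2` the erasure channel has a symmetric extension: hand the input to one receiver with
probability `p`, to a second with probability `p`, and to nobody otherwise; each receiver then sees
exactly the erasure channel (`erasureBroadcast_marginal_left`, `erasureBroadcast_marginal_right`).
Forward classical messages can be copied, so both receivers can run the decoder of the same code,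
and a good code would clone every pure state. The quantitative no-cloning bound
`IsPositivePairing.no_cloning` forces infidelity at least `1/13` as soon as one qubit is sent, so no
positive rate is achievable. Unassisted codes are a special case.

The argument uses only probabilities of product effects. Decoders are moved onto the effects by
`traceAdjoint`, so no joint decoder is ever formed. -/

theorem posSemidef_of_dotProduct_nonneg {a : Type*} [Fintype a] {M : Matrix a a ℂ}
    (h : ∀ v : a → ℂ, 0 ≤ star v ⬝ᵥ M *ᵥ v) : M.PosSemidef := by
  classical
  rw [← Matrix.isPositive_toEuclideanLin_iff, LinearMap.isPositive_iff_complex]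
  intro v
  have hv : inner ℂ (M.toEuclideanLin v) v = star (star (v.ofLp) ⬝ᵥ M *ᵥ v.ofLp) := by
    rw [EuclideanSpace.inner_eq_star_dotProduct, Matrix.star_dotProduct, star_star, dotProduct_comm]
    rfl
  have h0 := h v.ofLp
  rw [hv]
  have h1 := (Complex.nonneg_iff.1 h0)
  constructor
  · apply Complex.ext <;> simp [← h1.2]
  · simpa using h1.1

theorem trace_mul_vecMulVec_star {a : Type*} [Fintype a] (M : Matrix a a ℂ) (v : a → ℂ) :
    (M * vecMulVec v (star v)).trace = star v ⬝ᵥ M *ᵥ v := by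
  rw [Matrix.mul_vecMulVec, Matrix.trace_vecMulVec, dotProduct_comm]

theorem trace_mul_nonneg {a : Type*} [Fintype a] {A B : Matrix a a ℂ}
    (hA : A.PosSemidef) (hB : B.PosSemidef) : 0 ≤ (A * B).trace := by
  obtain ⟨m, v, rfl⟩ := Matrix.posSemidef_iff_eq_sum_vecMulVec.1 hB
  rw [Matrix.mul_sum, Matrix.trace_sum]
  refine Finset.sum_nonneg fun i _ => ?_
  rw [trace_mul_vecMulVec_star]
  exact hA.dotProduct_mulVec_nonneg _

/-- The case `k = 1`; this is all that the argument needs of complete positivity. -/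
theorem IsCompletelyPositive.posSemidef {a b : Type*} {Φ : Matrix a a ℂ →ₗ[ℂ] Matrix b b ℂ}
    (h : IsCompletelyPositive Φ) {M : Matrix a a ℂ} (hM : M.PosSemidef) : (Φ M).PosSemidef :=
  (h 1 _ (hM.submatrix Prod.snd)).submatrix fun y => (0, y)

theorem posSemidef_one_sub_vecMulVec {a : Type*} [Fintype a] [DecidableEq a] {u : a → ℂ}
    (hu : star u ⬝ᵥ u = 1) : (1 - vecMulVec u (star u)).PosSemidef := by
  have h : (1 - vecMulVec u (star u)) =
      (1 - vecMulVec u (star u))ᴴ * (1 - vecMulVec u (star u)) := by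
    rw [conjTranspose_sub, conjTranspose_one, conjTranspose_vecMulVec, star_star]
    simp [sub_mul, mul_sub, vecMulVec_mul_vecMulVec, hu]
  rw [h]
  exact posSemidef_conjTranspose_mul_self _

theorem posSemidef_one_sub_vecMulVec_sub {a : Type*} [Fintype a] [DecidableEq a] {u v : a → ℂ}
    (hu : star u ⬝ᵥ u = 1) (hv : star v ⬝ᵥ v = 1) (huv : star u ⬝ᵥ v = 0) :
    (1 - vecMulVec u (star u) - vecMulVec v (star v)).PosSemidef := by
  have hvu : star v ⬝ᵥ u = 0 := by
    rw [Matrix.star_dotProduct, huv, star_zero]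
  set M := 1 - vecMulVec u (star u) - vecMulVec v (star v) with hM
  have h : M = Mᴴ * M := by
    rw [hM, conjTranspose_sub, conjTranspose_sub, conjTranspose_one, conjTranspose_vecMulVec,
      conjTranspose_vecMulVec, star_star, star_star]
    simp [sub_mul, mul_sub, vecMulVec_mul_vecMulVec, hu, hv, huv, hvu]
  rw [h]
  exact posSemidef_conjTranspose_mul_self _

/-! ### Adjoints of maps between matrix algebras -/

/-- The image of `A` under the adjoint of `Φ` for the trace pairing. -/
def traceAdjoint {a b : Type*} [Fintype b] [DecidableEq a]
    (Φ : Matrix a a ℂ →ₗ[ℂ] Matrix b b ℂ) (A : Matrix b b ℂ) : Matrix a a ℂ :=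
  Matrix.of fun j i => (A * Φ (Matrix.single i j 1)).trace

theorem trace_traceAdjoint_mul {a b : Type*} [Fintype a] [Fintype b] [DecidableEq a]
    (Φ : Matrix a a ℂ →ₗ[ℂ] Matrix b b ℂ) (A : Matrix b b ℂ) (σ : Matrix a a ℂ) :
    (traceAdjoint Φ A * σ).trace = (A * Φ σ).trace := by
  conv_rhs => rw [Matrix.matrix_eq_sum_single σ]
  simp only [map_sum, Matrix.mul_sum, Matrix.trace_sum]
  rw [Finset.sum_comm]
  simp only [Matrix.trace, Matrix.diag, Matrix.mul_apply, traceAdjoint, Matrix.of_apply]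
  refine Finset.sum_congr rfl fun j _ => Finset.sum_congr rfl fun i _ => ?_
  have h : Matrix.single i j (σ i j) = σ i j • Matrix.single i j (1 : ℂ) := by
    simp [Matrix.smul_single]
  rw [h, map_smul]
  simp only [Matrix.smul_apply, smul_eq_mul, mul_comm (σ i j), Finset.sum_mul, mul_assoc]

theorem traceAdjoint_add {a b : Type*} [Fintype b] [DecidableEq a]
    (Φ : Matrix a a ℂ →ₗ[ℂ] Matrix b b ℂ) (A B : Matrix b b ℂ) :
    traceAdjoint Φ (A + B) = traceAdjoint Φ A + traceAdjoint Φ B := by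
  ext i j
  simp [traceAdjoint, add_mul]

theorem traceAdjoint_one {a b : Type*} [Fintype a] [Fintype b] [DecidableEq a] [DecidableEq b]
    {Φ : Matrix a a ℂ →ₗ[ℂ] Matrix b b ℂ} (h : IsChannel Φ) : traceAdjoint Φ 1 = 1 := by
  ext i j
  by_cases hij : i = j
  · subst hij
    simp [traceAdjoint, h.tracePreserving]
  · simp [traceAdjoint, h.tracePreserving, hij, Ne.symm hij, Matrix.trace_single_eq_of_ne]

theorem traceAdjoint_posSemidef {a b : Type*} [Fintype a] [Fintype b] [DecidableEq a]
    {Φ : Matrix a a ℂ →ₗ[ℂ] Matrix b b ℂ} (h : IsCompletelyPositive Φ) {A : Matrix b b ℂ}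
    (hA : A.PosSemidef) : (traceAdjoint Φ A).PosSemidef := by
  refine posSemidef_of_dotProduct_nonneg fun v => ?_
  rw [← trace_mul_vecMulVec_star, trace_traceAdjoint_mul]
  exact trace_mul_nonneg hA (h.posSemidef (posSemidef_vecMulVec_self_star v))

/-! ### Tensor powers -/

theorem sum_pi_prod {b : Type*} [Fintype b] {n : ℕ} (f : Fin n → b → ℂ) :
    ∑ y : Fin n → b, ∏ i, f i (y i) = ∏ i, ∑ y, f i y := by
  classical
  rw [Finset.prod_univ_sum, Fintype.piFinset_univ]

theorem trace_tensorPower {a b : Type*} [Fintype a] [DecidableEq a] [Fintype b]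
    {Φ : Matrix a a ℂ →ₗ[ℂ] Matrix b b ℂ} (h : ∀ ρ, (Φ ρ).trace = ρ.trace) (n : ℕ)
    (M : Matrix (Fin n → a) (Fin n → a) ℂ) : (tensorPower Φ n M).trace = M.trace := by
  classical
  have h1 : ∀ x x' : Fin n → a, ∑ y : Fin n → b,
      ∏ i, Φ (Matrix.single (x i) (x' i) 1) (y i) (y i) = if x = x' then 1 else 0 := by
    intro x x'
    have h2 : ∀ i, ∑ y, Φ (Matrix.single (x i) (x' i) 1) y y = if x i = x' i then 1 else 0 := by
      intro i
      refine (h (Matrix.single (x i) (x' i) 1)).trans ?_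
      split_ifs with hi
      · rw [hi, Matrix.trace_single_eq_same]
      · rw [Matrix.trace_single_eq_of_ne _ _ _ hi]
    rw [sum_pi_prod (fun i y => Φ (Matrix.single (x i) (x' i) 1) y y)]
    simp only [h2]
    by_cases hx : x = x'
    · simp [hx]
    · obtain ⟨i, hi⟩ := Function.ne_iff.1 hx
      rw [if_neg hx]
      exact Finset.prod_eq_zero (Finset.mem_univ i) (if_neg hi)
  simp only [Matrix.trace, Matrix.diag, tensorPower, LinearMap.coe_mk, AddHom.coe_mk,
    Matrix.of_apply]
  rw [Finset.sum_comm]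
  refine Finset.sum_congr rfl fun x _ => ?_
  rw [Finset.sum_comm]
  simp [← Finset.mul_sum, h1]

/-- The map with weighted Kraus operators: `ρ ↦ ∑ₖ cₖ Kₖ ρ Kₖ*`. -/
def krausMap {a b k : Type*} [Fintype a] [Fintype k] (c : k → ℝ) (K : k → Matrix b a ℂ) :
    Matrix a a ℂ →ₗ[ℂ] Matrix b b ℂ where
  toFun ρ := ∑ i, (c i : ℂ) • (K i * ρ * (K i)ᴴ)
  map_add' ρ σ := by simp [Matrix.mul_add, Matrix.add_mul, Finset.sum_add_distrib, -Complex.coe_smul]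
  map_smul' z ρ := by simp [Finset.smul_sum, smul_smul, mul_comm, -Complex.coe_smul]

/-- The definition of `tensorPower` by matrix units hides positivity; the product Kraus form
exhibits it once the weights are nonnegative. -/
theorem tensorPower_krausMap {a b k : Type*} [Fintype a] [DecidableEq a] [Fintype b] [Fintype k]
    (c : k → ℝ) (K : k → Matrix b a ℂ) (n : ℕ) :
    tensorPower (krausMap c K) n = krausMap (fun κ : Fin n → k => ∏ i, c (κ i))
      (fun κ => Matrix.of fun y x => ∏ i, K (κ i) (y i) (x i)) := by
  classical
  have h0 : ∀ s t y z, krausMap c K (Matrix.single s t 1) y z =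
      ∑ l, (c l : ℂ) * (K l y s * star (K l z t)) := by
    intro s t y z
    simp [krausMap, Matrix.sum_apply, Matrix.mul_apply, Matrix.single_apply, ite_and]
  refine LinearMap.ext fun M => Matrix.ext fun y z => ?_
  simp only [tensorPower, LinearMap.coe_mk, AddHom.coe_mk, Matrix.of_apply, h0]
  simp only [Finset.prod_univ_sum, Fintype.piFinset_univ, Finset.mul_sum]
  rw [krausMap]
  simp only [LinearMap.coe_mk, AddHom.coe_mk, Matrix.sum_apply, Matrix.smul_apply,
    Matrix.mul_apply, Matrix.conjTranspose_apply, Matrix.of_apply, smul_eq_mul, Finset.mul_sum,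
    Finset.sum_mul, Finset.prod_mul_distrib, star_prod, Complex.ofReal_prod]
  rw [Finset.sum_comm]
  conv_rhs => rw [Finset.sum_comm]
  refine Finset.sum_congr rfl fun x' _ => ?_
  rw [Finset.sum_comm]
  refine Finset.sum_congr rfl fun κ _ => Finset.sum_congr rfl fun x _ => ?_
  ring

theorem krausMap_posSemidef {a b k : Type*} [Fintype a] [Fintype b] [Fintype k] {c : k → ℝ}
    (hc : ∀ i, 0 ≤ c i) (K : k → Matrix b a ℂ) {M : Matrix a a ℂ} (hM : M.PosSemidef) :
    (krausMap c K M).PosSemidef :=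
  posSemidef_sum _ fun i _ =>
    (hM.mul_mul_conjTranspose_same (K i)).smul (Complex.zero_le_real.2 (hc i))

/-! ### Marginals of tensor powers -/

/-- The operator `A ⊗ B` on `n` pairs of systems, with `A` acting on the first and `B` on the second
components. -/
def pairKronecker {b : Type*} {n : ℕ} (A B : Matrix (Fin n → b) (Fin n → b) ℂ) :
    Matrix (Fin n → b × b) (Fin n → b × b) ℂ :=
  (A ⊗ₖ B).submatrix (Equiv.arrowProdEquivProdArrow (Fin n) (fun _ => b) (fun _ => b))
    (Equiv.arrowProdEquivProdArrow (Fin n) (fun _ => b) (fun _ => b))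

theorem pairKronecker_posSemidef {b : Type*} [Fintype b] {n : ℕ}
    {A B : Matrix (Fin n → b) (Fin n → b) ℂ} (hA : A.PosSemidef) (hB : B.PosSemidef) :
    (pairKronecker A B).PosSemidef := by
  classical
  exact (hA.kronecker hB).submatrix _

theorem trace_pairKronecker_mul {b : Type*} [Fintype b] {n : ℕ}
    (A B : Matrix (Fin n → b) (Fin n → b) ℂ) (T : Matrix (Fin n → b × b) (Fin n → b × b) ℂ) :
    (pairKronecker A B * T).trace = ∑ u, ∑ v, ∑ u', ∑ v', A u u' * B v v' *
      T (fun i => (u' i, v' i)) (fun i => (u i, v i)) := by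
  classical
  let e := Equiv.arrowProdEquivProdArrow (Fin n) (fun _ => b) (fun _ => b)
  refine (Fintype.sum_equiv e _ (fun q => ∑ u', ∑ v', A q.1 u' * B q.2 v' *
      T (fun i => (u' i, v' i)) (fun i => (q.1 i, q.2 i))) fun y => ?_).trans
    (Fintype.sum_prod_type _)
  rw [Matrix.diag, Matrix.mul_apply]
  exact (Fintype.sum_equiv e _ (fun q' => A (e y).1 q'.1 * B (e y).2 q'.2 *
      T (fun i => (q'.1 i, q'.2 i)) (fun i => ((e y).1 i, (e y).2 i))) fun y' => rfl).trans
    (Fintype.sum_prod_type _)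

/-- The effect `1` traces out the second receiver, and on matrix units this partial trace factors
over the `n` coordinates. -/
theorem trace_pairKronecker_one_right {a b : Type*} [Fintype a] [DecidableEq a] [Fintype b]
    [DecidableEq b] {W : Matrix a a ℂ →ₗ[ℂ] Matrix (b × b) (b × b) ℂ}
    {Φ : Matrix a a ℂ →ₗ[ℂ] Matrix b b ℂ}
    (h : ∀ ρ u u', ∑ v, W ρ (u, v) (u', v) = Φ ρ u u') {n : ℕ}
    (A : Matrix (Fin n → b) (Fin n → b) ℂ) (M : Matrix (Fin n → a) (Fin n → a) ℂ) :
    (pairKronecker A 1 * tensorPower W n M).trace = (A * tensorPower Φ n M).trace := by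
  rw [trace_pairKronecker_mul]
  simp only [Matrix.trace, Matrix.diag, Matrix.mul_apply]
  refine Finset.sum_congr rfl fun u _ => ?_
  rw [Finset.sum_comm]
  refine Finset.sum_congr rfl fun u' _ => ?_
  simp only [Matrix.one_apply, mul_ite, mul_one, mul_zero, ite_mul, zero_mul, Finset.sum_ite_eq,
    Finset.mem_univ, if_true, ← Finset.mul_sum]
  congr 1
  simp only [tensorPower, LinearMap.coe_mk, AddHom.coe_mk, Matrix.of_apply]
  rw [Finset.sum_comm]
  refine Finset.sum_congr rfl fun x _ => ?_
  rw [Finset.sum_comm]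
  refine Finset.sum_congr rfl fun x' _ => ?_
  rw [← Finset.mul_sum,
    sum_pi_prod (fun i v => W (Matrix.single (x i) (x' i) 1) (u' i, v) (u i, v))]
  simp only [h]

theorem trace_pairKronecker_one_left {a b : Type*} [Fintype a] [DecidableEq a] [Fintype b]
    [DecidableEq b] {W : Matrix a a ℂ →ₗ[ℂ] Matrix (b × b) (b × b) ℂ}
    {Φ : Matrix a a ℂ →ₗ[ℂ] Matrix b b ℂ}
    (h : ∀ ρ v v', ∑ u, W ρ (u, v) (u, v') = Φ ρ v v') {n : ℕ}
    (B : Matrix (Fin n → b) (Fin n → b) ℂ) (M : Matrix (Fin n → a) (Fin n → a) ℂ) :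
    (pairKronecker 1 B * tensorPower W n M).trace = (B * tensorPower Φ n M).trace := by
  rw [trace_pairKronecker_mul, Finset.sum_comm]
  simp only [Matrix.trace, Matrix.diag, Matrix.mul_apply]
  refine Finset.sum_congr rfl fun v _ => ?_
  simp only [Matrix.one_apply, ite_mul, one_mul, zero_mul, Finset.sum_ite_irrel,
    Finset.sum_const_zero, Finset.sum_ite_eq, Finset.mem_univ, if_true]
  rw [Finset.sum_comm]
  refine Finset.sum_congr rfl fun v' _ => ?_
  rw [← Finset.mul_sum]
  congr 1
  simp only [tensorPower, LinearMap.coe_mk, AddHom.coe_mk, Matrix.of_apply]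
  rw [Finset.sum_comm]
  refine Finset.sum_congr rfl fun x _ => ?_
  rw [Finset.sum_comm]
  refine Finset.sum_congr rfl fun x' _ => ?_
  rw [← Finset.mul_sum,
    sum_pi_prod (fun i u => W (Matrix.single (x i) (x' i) 1) (u, v' i) (u, v i))]
  simp only [h]

/-! ### Symmetric extension of the erasure channel -/

/-- The probabilities that the first receiver, the second receiver, or nobody gets the input. -/
def broadcastWeight {a : Type*} (p : ℝ) : Option (Option a) → ℝ
  | none => p
  | some none => p
  | some (some _) => 1 - 2 * p

/-- Kraus operators handing the input to the first receiver, to the second receiver, or to the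
environment; whoever does not get it receives the erasure state. -/
def broadcastKraus (a : Type*) [DecidableEq a] :
    Option (Option a) → Matrix ((a ⊕ Unit) × (a ⊕ Unit)) a ℂ
  | none => Matrix.of fun y x => if y = (Sum.inl x, Sum.inr ()) then 1 else 0
  | some none => Matrix.of fun y x => if y = (Sum.inr (), Sum.inl x) then 1 else 0
  -- One operator per basis vector: together they discard the input and leave its trace on the
  -- doubly erased state.
  | some (some i) => Matrix.of fun y x =>
      if y = (Sum.inr (), Sum.inr ()) ∧ x = i then 1 else 0

/-- A channel to two receivers both of whose marginals are `erasureChannel a p`, for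
`p ≤ 1 / 2`. -/
def erasureBroadcast (a : Type*) [Fintype a] [DecidableEq a] (p : ℝ) :
    Matrix a a ℂ →ₗ[ℂ] Matrix ((a ⊕ Unit) × (a ⊕ Unit)) ((a ⊕ Unit) × (a ⊕ Unit)) ℂ :=
  krausMap (broadcastWeight p) (broadcastKraus a)

/-- The two branches that erase this receiver have total weight `p + (1 - 2p) = 1 - p`. No coherence
with the flag survives, since each Kraus operator puts the receiver wholly in one summand. -/
theorem erasureBroadcast_marginal_left (a : Type*) [Fintype a] [DecidableEq a] (p : ℝ)
    (ρ : Matrix a a ℂ) (u u' : a ⊕ Unit) :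
    ∑ v, erasureBroadcast a p ρ (u, v) (u', v) = erasureChannel a p ρ u u' := by
  rcases u with u | u <;> rcases u' with u' | u' <;>
  simp [erasureBroadcast, krausMap, erasureChannel, broadcastWeight, broadcastKraus,
    Matrix.sum_apply, Matrix.mul_apply, Fintype.sum_option, Matrix.trace, Finset.sum_add_distrib,
    ite_and, ← Finset.mul_sum, Finset.sum_ite_irrel]
  ring

theorem erasureBroadcast_marginal_right (a : Type*) [Fintype a] [DecidableEq a] (p : ℝ)
    (ρ : Matrix a a ℂ) (v v' : a ⊕ Unit) :
    ∑ u, erasureBroadcast a p ρ (u, v) (u, v') = erasureChannel a p ρ v v' := by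
  rcases v with v | v <;> rcases v' with v' | v' <;>
  simp [erasureBroadcast, krausMap, erasureChannel, broadcastWeight, broadcastKraus,
    Matrix.sum_apply, Matrix.mul_apply, Fintype.sum_option, Matrix.trace, Finset.sum_add_distrib,
    ite_and, ← Finset.mul_sum, Finset.sum_ite_irrel]
  ring

theorem tensorPower_erasureBroadcast_posSemidef {a : Type*} [Fintype a] [DecidableEq a] {p : ℝ}
    (h0 : 0 ≤ p) (h1 : p ≤ 1 / 2) (n : ℕ) {M : Matrix (Fin n → a) (Fin n → a) ℂ}
    (hM : M.PosSemidef) : (tensorPower (erasureBroadcast a p) n M).PosSemidef := by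
  rw [erasureBroadcast, tensorPower_krausMap]
  refine krausMap_posSemidef (fun κ => Finset.prod_nonneg fun i _ => ?_) _ hM
  -- The weight `1 - 2 * p` is where `p ≤ 1/2` enters.
  rcases κ i with _ | _ | _ <;> simp only [broadcastWeight] <;> linarith

theorem trace_erasureChannel {a : Type*} [Fintype a] (p : ℝ) (ρ : Matrix a a ℂ) :
    (erasureChannel a p ρ).trace = ρ.trace := by
  simp [erasureChannel, Matrix.trace, ← Finset.mul_sum]
  ring

/-! ### No cloning -/

/-- A family of numbers `F A B ρ`, additive in each argument and nonnegative on positive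
semidefinite ones: the probability that two receivers observe the effects `A` and `B` on their
outputs when `ρ` is sent. -/
structure IsPositivePairing {d : Type*} [Fintype d]
    (F : Matrix d d ℂ → Matrix d d ℂ → Matrix d d ℂ → ℝ) : Prop where
  add_left : ∀ A A' B ρ, F (A + A') B ρ = F A B ρ + F A' B ρ
  add_right : ∀ A B B' ρ, F A (B + B') ρ = F A B ρ + F A B' ρ
  add_state : ∀ A B ρ σ, F A B (ρ + σ) = F A B ρ + F A B σ
  nonneg : ∀ {A B ρ}, A.PosSemidef → B.PosSemidef → ρ.PosSemidef → 0 ≤ F A B ρ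

namespace IsPositivePairing

variable {d : Type*} [Fintype d]
  {F : Matrix d d ℂ → Matrix d d ℂ → Matrix d d ℂ → ℝ}

theorem swap (hF : IsPositivePairing F) : IsPositivePairing fun A B ρ => F B A ρ where
  add_left A A' B ρ := hF.add_right B A A' ρ
  add_right A B B' ρ := hF.add_left B B' A ρ
  add_state A B ρ σ := hF.add_state B A ρ σ
  nonneg hA hB hρ := hF.nonneg hB hA hρ

/-- The parallelogram identity for the projectors of `(u + v) ± v`, dropping the nonnegative term of
`u + 2v`. The factor 4 is 2 divided by `|c|² = 1/2`. -/
theorem le_superposition (hF : IsPositivePairing F) {A B : Matrix d d ℂ} (hA : A.PosSemidef)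
    (hB : B.PosSemidef) {c : ℂ} (hc : c * star c = 1 / 2) (u v : d → ℂ) :
    F A B (vecMulVec u (star u)) ≤ 4 * F A B (vecMulVec (c • (u + v)) (star (c • (u + v)))) +
      2 * F A B (vecMulVec v (star v)) := by
  have h : vecMulVec u (star u) + vecMulVec (u + v + v) (star (u + v + v)) =
      (vecMulVec (c • (u + v)) (star (c • (u + v))) + vecMulVec (c • (u + v)) (star (c • (u + v))))
      + (vecMulVec (c • (u + v)) (star (c • (u + v))) +
        vecMulVec (c • (u + v)) (star (c • (u + v))))
      + (vecMulVec v (star v) + vecMulVec v (star v)) := by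
    ext i j
    simp only [vecMulVec_apply, Matrix.add_apply, Pi.star_apply, Pi.add_apply, Pi.smul_apply,
      smul_eq_mul, star_mul', star_add]
    linear_combination (-4 * (u i + v i) * (star (u j) + star (v j))) * hc
  have h' := congrArg (F A B) h
  simp only [hF.add_state] at h'
  linarith [hF.nonneg hA hB (posSemidef_vecMulVec_self_star (u + v + v))]

variable [DecidableEq d]

theorem le_one_right (hF : IsPositivePairing F) {A B ρ : Matrix d d ℂ} (hA : A.PosSemidef)
    (hB : (1 - B).PosSemidef) (hρ : ρ.PosSemidef) : F A B ρ ≤ F A 1 ρ := by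
  have h := hF.add_right A B (1 - B) ρ
  rw [add_sub_cancel] at h
  linarith [hF.nonneg hA hB hρ]

theorem le_one_left (hF : IsPositivePairing F) {A B ρ : Matrix d d ℂ} (hA : (1 - A).PosSemidef)
    (hB : B.PosSemidef) (hρ : ρ.PosSemidef) : F A B ρ ≤ F 1 B ρ :=
  hF.swap.le_one_right hB hA hρ

variable {δ : ℝ}

theorem compl_le (hF : IsPositivePairing F) {u : d → ℂ}
    (h1 : F 1 1 (vecMulVec u (star u)) = 1)
    (hδ : 1 - δ ≤ F (vecMulVec u (star u)) 1 (vecMulVec u (star u))) :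
    F (1 - vecMulVec u (star u)) 1 (vecMulVec u (star u)) ≤ δ := by
  have h := hF.add_left (vecMulVec u (star u)) (1 - vecMulVec u (star u)) 1 (vecMulVec u (star u))
  rw [add_sub_cancel, h1] at h
  linarith

/-- By orthogonality the projector onto `v` lies below the complement of that onto `u`. -/
theorem orthogonal_le (hF : IsPositivePairing F) {u v : d → ℂ} (hu : star u ⬝ᵥ u = 1)
    (hv : star v ⬝ᵥ v = 1) (huv : star u ⬝ᵥ v = 0)
    (h1 : F 1 1 (vecMulVec u (star u)) = 1)
    (hδ : 1 - δ ≤ F (vecMulVec u (star u)) 1 (vecMulVec u (star u))) :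
    F (vecMulVec v (star v)) 1 (vecMulVec u (star u)) ≤ δ := by
  have h := hF.add_left (vecMulVec v (star v)) (1 - vecMulVec u (star u) - vecMulVec v (star v)) 1
    (vecMulVec u (star u))
  rw [add_sub_cancel] at h
  linarith [hF.compl_le h1 hδ, hF.nonneg (posSemidef_one_sub_vecMulVec_sub hu hv huv)
    PosSemidef.one (posSemidef_vecMulVec_self_star u)]

/-- Two receivers cannot both recover all pure states of a system of dimension at least two. -/
theorem no_cloning (hF : IsPositivePairing F) {e f : d → ℂ} (he : star e ⬝ᵥ e = 1)
    (hf : star f ⬝ᵥ f = 1) (hef : star e ⬝ᵥ f = 0)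
    (h1 : ∀ v : d → ℂ, star v ⬝ᵥ v = 1 → F 1 1 (vecMulVec v (star v)) = 1)
    (hl : ∀ v : d → ℂ, star v ⬝ᵥ v = 1 →
      1 - δ ≤ F (vecMulVec v (star v)) 1 (vecMulVec v (star v)))
    (hr : ∀ v : d → ℂ, star v ⬝ᵥ v = 1 →
      1 - δ ≤ F 1 (vecMulVec v (star v)) (vecMulVec v (star v))) : 1 ≤ 13 * δ := by
  obtain ⟨c, hc⟩ : ∃ c : ℂ, c * star c = 1 / 2 := by
    refine ⟨(√(1 / 2) : ℝ), ?_⟩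
    rw [← starRingEnd_apply, Complex.conj_ofReal, ← Complex.ofReal_mul,
      Real.mul_self_sqrt (by norm_num)]
    norm_num
  have hfe : star f ⬝ᵥ e = 0 := by rw [Matrix.star_dotProduct, hef, star_zero]
  set s := c • (e + f) with hs
  set t := c • (e + -f) with ht
  have hs1 : star s ⬝ᵥ s = 1 := by
    simp only [hs, star_smul, star_add, smul_dotProduct, dotProduct_smul, add_dotProduct,
      dotProduct_add, he, hf, hef, hfe, smul_eq_mul]
    linear_combination 2 * hc
  have ht1 : star t ⬝ᵥ t = 1 := by
    simp only [ht, star_smul, star_add, star_neg, smul_dotProduct, dotProduct_smul, add_dotProduct,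
      dotProduct_add, neg_dotProduct, dotProduct_neg, he, hf, hef, hfe, smul_eq_mul]
    linear_combination 2 * hc
  have hts : star t ⬝ᵥ s = 0 := by
    simp only [hs, ht, star_smul, star_add, star_neg, smul_dotProduct, dotProduct_smul,
      add_dotProduct, dotProduct_add, neg_dotProduct, he, hf, hef, hfe, smul_eq_mul]
    ring
  have hp : ∀ v : d → ℂ, (vecMulVec v (star v)).PosSemidef := posSemidef_vecMulVec_self_star
  have hcs := posSemidef_one_sub_vecMulVec hs1
  have hce := posSemidef_one_sub_vecMulVec he
  have hcs' : (1 - (1 - vecMulVec s (star s))).PosSemidef := by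
    rw [sub_sub_cancel]
    exact hp s
  -- When `e` is sent, the first receiver tests `e` while the second tests the incompatible `s`.
  -- Each outcome of the second test is shown to be unlikely.
  have hsplit : F 1 1 (vecMulVec e (star e)) =
      F (vecMulVec e (star e)) (vecMulVec s (star s)) (vecMulVec e (star e)) +
      F (vecMulVec e (star e)) (1 - vecMulVec s (star s)) (vecMulVec e (star e)) +
      F (1 - vecMulVec e (star e)) 1 (vecMulVec e (star e)) := by
    rw [← hF.add_right, add_sub_cancel, ← hF.add_left, add_sub_cancel]
  -- Outcome `s` is rare for input `t`, outcome `1 - s` is rare for input `s`, and the first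
  -- receiver's outcome `e` is rare for input `f`. So `e` is expanded through `t` and `f`, then
  -- through `s` and `f`.
  have hA := hF.le_superposition (hp e) (hp s) hc e (-f)
  have hB := hF.le_superposition (hp e) hcs hc e f
  rw [← ht, star_neg, vecMulVec_neg, neg_vecMulVec, neg_neg] at hA
  rw [← hs] at hB
  have hef' := hF.orthogonal_le hf he hfe (h1 f hf) (hl f hf)
  have h2 := hF.le_one_left hce (hp s) (hp t)
  have h3 := hF.swap.orthogonal_le ht1 hs1 hts (h1 t ht1) (hr t ht1)
  have h4 := hF.le_one_left hce hcs (hp s)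
  have h5 := hF.swap.compl_le (h1 s hs1) (hr s hs1)
  have h6 := hF.le_one_right (hp e) hcs (hp f)
  have h7 := hF.le_one_right (hp e) hcs' (hp f)
  have h8 := hF.compl_le (h1 e he) (hl e he)
  have h9 := h1 e he
  -- The total is `(4 + 2) + (4 + 2) + 1 = 13` times `δ`.
  linarith

end IsPositivePairing

/-! ### Codes for the erasure channel -/

/-- The probability that two receivers, who both use the decoder of `C` on their outputs of
`erasureBroadcast`, observe the effects `A` and `B`. -/
def jointProbability {a : Type*} [Fintype a] [DecidableEq a] {n m : ℕ}
    (C : OneWayCode a (a ⊕ Unit) n m) (p : ℝ)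
    (A B ρ : Matrix (Fin m → Fin 2) (Fin m → Fin 2) ℂ) : ℝ :=
  -- The same `x` occurs in both factors: the classical message is copied to both receivers.
  (∑ x, (pairKronecker (traceAdjoint (C.decode x) A) (traceAdjoint (C.decode x) B) *
    tensorPower (erasureBroadcast a p) n (C.encode x ρ)).trace).re

section

variable {a : Type*} [Fintype a] [DecidableEq a] {n m : ℕ}

theorem isPositivePairing_jointProbability (C : OneWayCode a (a ⊕ Unit) n m) {p : ℝ}
    (h0 : 0 ≤ p) (h1 : p ≤ 1 / 2) : IsPositivePairing (jointProbability C p) where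
  add_left A A' B ρ := by
    have h : ∀ X X' Y : Matrix (Fin n → a ⊕ Unit) (Fin n → a ⊕ Unit) ℂ,
        pairKronecker (X + X') Y = pairKronecker X Y + pairKronecker X' Y := by
      intro X X' Y
      ext
      simp [pairKronecker, add_mul]
    simp [jointProbability, traceAdjoint_add, h, Matrix.add_mul, Finset.sum_add_distrib]
  add_right A B B' ρ := by
    have h : ∀ X Y Y' : Matrix (Fin n → a ⊕ Unit) (Fin n → a ⊕ Unit) ℂ,
        pairKronecker X (Y + Y') = pairKronecker X Y + pairKronecker X Y' := by
      intro X Y Y'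
      ext
      simp [pairKronecker, mul_add]
    simp [jointProbability, traceAdjoint_add, h, Matrix.add_mul, Finset.sum_add_distrib]
  add_state A B ρ σ := by
    simp [jointProbability, Matrix.mul_add, Finset.sum_add_distrib]
  nonneg {A B ρ} hA hB hρ := by
    refine (Complex.nonneg_iff.1 (Finset.sum_nonneg fun x _ => ?_)).1
    have hD := (C.decode_isChannel x).completelyPositive
    exact trace_mul_nonneg
      (pairKronecker_posSemidef (traceAdjoint_posSemidef hD hA) (traceAdjoint_posSemidef hD hB))
      (tensorPower_erasureBroadcast_posSemidef h0 h1 n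
        ((C.encode_completelyPositive x).posSemidef hρ))

theorem trace_mul_transmit {b : Type*} [Fintype b] [DecidableEq b] (C : OneWayCode a b n m)
    (N : Matrix a a ℂ →ₗ[ℂ] Matrix b b ℂ) (A ρ : Matrix (Fin m → Fin 2) (Fin m → Fin 2) ℂ) :
    (A * C.transmit N ρ).trace =
      ∑ x, (traceAdjoint (C.decode x) A * tensorPower N n (C.encode x ρ)).trace := by
  simp [OneWayCode.transmit, LinearMap.sum_apply, Matrix.mul_sum, Matrix.trace_sum,
    trace_traceAdjoint_mul]

/-- A trace-preserving decoder pulls the effect `1` back to `1`, so ignoring one receiver leaves the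
original code on the erasure channel. -/
theorem jointProbability_one_right (C : OneWayCode a (a ⊕ Unit) n m) (p : ℝ)
    (A ρ : Matrix (Fin m → Fin 2) (Fin m → Fin 2) ℂ) :
    jointProbability C p A 1 ρ = (A * C.transmit (erasureChannel a p) ρ).trace.re := by
  simp only [jointProbability, trace_mul_transmit, traceAdjoint_one (C.decode_isChannel _),
    trace_pairKronecker_one_right (erasureBroadcast_marginal_left a p)]

theorem jointProbability_one_left (C : OneWayCode a (a ⊕ Unit) n m) (p : ℝ)
    (B ρ : Matrix (Fin m → Fin 2) (Fin m → Fin 2) ℂ) :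
    jointProbability C p 1 B ρ = (B * C.transmit (erasureChannel a p) ρ).trace.re := by
  simp only [jointProbability, trace_mul_transmit, traceAdjoint_one (C.decode_isChannel _),
    trace_pairKronecker_one_left (erasureBroadcast_marginal_right a p)]

theorem jointProbability_one_one (C : OneWayCode a (a ⊕ Unit) n m) (p : ℝ)
    (ρ : Matrix (Fin m → Fin 2) (Fin m → Fin 2) ℂ) :
    jointProbability C p 1 1 ρ = ρ.trace.re := by
  rw [jointProbability_one_left, trace_mul_transmit]
  simp only [traceAdjoint_one (C.decode_isChannel _), Matrix.one_mul,
    trace_tensorPower (trace_erasureChannel p), C.encode_tracePreserving]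

/-- An erasure channel with survival probability at most one half transmits no qubit reliably. -/
theorem OneWayCode.not_hasFidelity_erasureChannel (C : OneWayCode a (a ⊕ Unit) n m) {p : ℝ}
    (h0 : 0 ≤ p) (h1 : p ≤ 1 / 2) (hm : 0 < m) {ε : ℝ} (hε : 13 * ε < 1) :
    ¬ C.HasFidelity (erasureChannel a p) ε := by
  intro hC
  -- With `m > 0` there are two distinct bit strings, hence two orthonormal states.
  have hne : (fun _ => 0 : Fin m → Fin 2) ≠ fun _ => 1 :=
    fun h => zero_ne_one (congrFun h ⟨0, hm⟩)
  refine hε.not_ge ((isPositivePairing_jointProbability C h0 h1).no_cloning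
    (e := Pi.single (fun _ => 0) 1) (f := Pi.single (fun _ => 1) 1) ?_ ?_ ?_ ?_ ?_ ?_)
  · simp
  · simp
  · simp [hne]
  · intro v hv
    rw [jointProbability_one_one, Matrix.trace_vecMulVec, dotProduct_comm, hv, Complex.one_re]
  · intro v hv
    rw [jointProbability_one_right, Matrix.trace_mul_comm, trace_mul_vecMulVec_star]
    exact hC v hv
  · intro v hv
    rw [jointProbability_one_left, Matrix.trace_mul_comm, trace_mul_vecMulVec_star]
    exact hC v hv

theorem not_isOneWayAchievable_erasureChannel {p : ℝ} (h0 : 0 ≤ p) (h1 : p ≤ 1 / 2) {R : ℝ≥0}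
    (hR : R ≠ 0) : ¬ IsOneWayAchievable (erasureChannel a p) R := by
  intro h
  -- Any infidelity below `1/13` would do; `n > 0` makes `R * n` positive and so forces `m > 0`.
  obtain ⟨n, ⟨m, hm, C, hC⟩, hn⟩ :=
    ((h (1 / 20) (by norm_num)).and_eventually (Filter.eventually_gt_atTop 0)).exists
  have hm0 : 0 < m := by
    have h2 : (0 : ℝ) < R * n :=
      mul_pos (NNReal.coe_pos.2 (pos_iff_ne_zero.2 hR)) (Nat.cast_pos.2 hn)
    exact_mod_cast h2.trans_le hm
  exact C.not_hasFidelity_erasureChannel h0 h1 hm0 (by norm_num) hC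

theorem oneWayQuantumCapacity_erasureChannel {p : ℝ} (h0 : 0 ≤ p) (h1 : p ≤ 1 / 2) :
    oneWayQuantumCapacity (erasureChannel a p) = 0 := by
  refine le_antisymm (iSup₂_le fun R hR => ?_) zero_le
  by_contra h
  exact not_isOneWayAchievable_erasureChannel h0 h1 (fun h' => h (by simp [h'])) hR

end

theorem unassistedQuantumCapacity_le {a b : Type*} [Fintype a] [DecidableEq a] [Fintype b]
    (N : Matrix a a ℂ →ₗ[ℂ] Matrix b b ℂ) :
    unassistedQuantumCapacity N ≤ oneWayQuantumCapacity N := by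
  refine iSup₂_le fun R hR => le_iSup₂_of_le R (fun ε hε => (hR ε hε).mono ?_) le_rfl
  rintro n ⟨m, hm, C, -, hC⟩
  exact ⟨m, hm, C, hC⟩

theorem Link.ebitProbability_nonneg (ℓ : Link) : 0 ≤ ℓ.ebitProbability :=
  mul_nonneg (mul_nonneg ℓ.upEfficiency_mem.1 ℓ.downEfficiency_mem.1) (Real.exp_pos _).le

end DMD

theorem lemma2 (ℓ : DMD.Link) :
    (DMD.oneWayQuantumCapacity ℓ.channel ≠ 0 → 1 / 2 < ℓ.ebitProbability) ∧
      (DMD.unassistedQuantumCapacity ℓ.channel ≠ 0 → 1 / 2 < ℓ.ebitProbability) := by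
  have h : DMD.oneWayQuantumCapacity ℓ.channel ≠ 0 → 1 / 2 < ℓ.ebitProbability := by
    intro h
    by_contra! hp
    exact h (DMD.oneWayQuantumCapacity_erasureChannel ℓ.ebitProbability_nonneg hp)
  refine ⟨h, fun h' => h fun h0 => h' ?_⟩
  exact le_antisymm (h0 ▸ DMD.unassistedQuantumCapacity_le ℓ.channel) zero_le
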